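/- **Theorem 2 (Global convergence).** Let $m\ge 0$, $n\ge 1$, $A\in\mathbb R^{m\times n}$, $b\in\mathbb R^m$, and let $\lambda_1\ge\lambda_2\ge\cdots\ge\lambda_n\ge 0$ with $\lambda_1>0$. For $x\in\mathbb R^n$ let $|x|^{\downarrow}_1\ge\cdots\ge|x|^{\downarrow}_n$ be the absolute values of the entries of $x$ in non-increasing order, and put $$\kappa_\lambda(x)=\sum_{i=1}^n\lambda_i|x|^{\downarrow}_i,\qquad \kappa_\lambda^*(v)=\sup_{x\in\mathbb R^n}\{\langle x,v\rangle-\kappa_\lambda(x)\}\in[0,+\infty].$$ Consider the SLOPE problem and its dual $$(P)\ \max_{x\in\mathbb R^n}\Big\{-\tfrac12\|Ax-b\|^2-\kappa_\lambda(x)\Big\},\qquad (D)\ \min_{y\in\mathbb R^m}\Big\{\tfrac12\|y\|^2+\langle b,y\rangle+\kappa_\lambda^*(-A^\top y)\Big\},$$ and, for $\sigma>0$, the augmented Lagrangian of $(D)$ $$L_\sigma(y;x)=\tfrac12\|y\|^2+\langle b,y\rangle+\inf_{s\in\mathbb R^n}\Big\{\kappa_\lambda^*(s)-\langle x,A^\top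 y+s\rangle+\tfrac{\sigma}{2}\|A^\top y+s\|^2\Big\}.$$ Let $0<\sigma_0\le\sigma_1\le\sigma_2\le\cdots$ be a non-decreasing sequence of real numbers (bounded or not), let $\epsilon_k\ge 0$ with $\sum_{k\ge0}\epsilon_k<\infty$, and let $(y^0,x^0)\in\mathbb R^m\times\mathbb R^n$. Let $\{(y^k,x^k)\}_{k\ge0}$ be any infinite sequence such that, for every $k\ge0$, with $\Psi_k(y):=L_{\sigma_k}(y;x^k)$, $$\|\nabla\Psi_k(y^{k+1})\|\le\frac{\epsilon_k}{\sqrt{\sigma_k}}\quad\text{(A)},\qquad x^{k+1}=\operatorname{Prox}_{\sigma_k\kappa_\lambda}\big(x^k-\sigma_kA^\top y^{k+1}\big),$$ where $\operatorname{Prox}_{h}(z)=\arg\min_{u\in\mathbb R^n}\{\tfrac12\|u-z\|^2+h(u)\}$. Then $\{x^k\}$ converges to an optimal solution of $(P)$, the problem $(D)$ has exactly one optimal solution, and $\{y^k\}$ converges to it. -/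

import Mathlib

noncomputable section

namespace SLOPE

open Set Filter Topology

/-- The vector `|x|↓`: the absolute values of the entries of `x`, in non-increasing order. -/
def absSorted {n : ℕ} (x : EuclideanSpace ℝ (Fin n)) : Fin n → ℝ :=
  fun i => |x (Tuple.sort (fun j => -|x j|) i)|

theorem absSorted_antitone {n : ℕ} (x : EuclideanSpace ℝ (Fin n)) : Antitone (absSorted x) := by
  intro i j hij
  have h := Tuple.monotone_sort (fun j => -|x j|) hij
  simpa [absSorted] using h

/-- The decreasing weighted sorted `ℓ₁` norm `κ_λ(x) = ∑ᵢ λᵢ |x|↓ᵢ`. -/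
def kappa {n : ℕ} (lam : Fin n → ℝ) (x : EuclideanSpace ℝ (Fin n)) : ℝ :=
  ∑ i, lam i * absSorted x i

/-- The Fenchel conjugate `κ_λ*(v) = sup_x {⟨x, v⟩ - κ_λ(x)}`, with values in `[-∞, ∞]`. -/
def kappaConj {n : ℕ} (lam : Fin n → ℝ) (v : EuclideanSpace ℝ (Fin n)) : EReal :=
  ⨆ x : EuclideanSpace ℝ (Fin n), ((inner ℝ x v - kappa lam x : ℝ) : EReal)

/-- `p` is a value of the proximal mapping of `h` at `z`, that is, a point of
`argmin_x {(1/2) ‖x - z‖² + h x}`. -/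
def IsProx {n : ℕ} (h : EuclideanSpace ℝ (Fin n) → ℝ) (z p : EuclideanSpace ℝ (Fin n)) : Prop :=
  IsMinOn (fun x => (1 / 2) * ‖x - z‖ ^ 2 + h x) univ p

/-- The objective `-f(x) = -(1/2) ‖A x - b‖² - κ_λ(x)` of the primal maximization problem (P). -/
def primalObj {m n : ℕ} (A : Matrix (Fin m) (Fin n) ℝ) (b : EuclideanSpace ℝ (Fin m))
    (lam : Fin n → ℝ) (x : EuclideanSpace ℝ (Fin n)) : ℝ :=
  -((1 / 2) * ‖A.toEuclideanLin x - b‖ ^ 2) - kappa lam x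

/-- The objective `g(y) = (1/2) ‖y‖² + ⟨b, y⟩ + κ_λ*(-Aᵀ y)` of the dual minimization
problem (D). -/
def dualObj {m n : ℕ} (A : Matrix (Fin m) (Fin n) ℝ) (b : EuclideanSpace ℝ (Fin m))
    (lam : Fin n → ℝ) (y : EuclideanSpace ℝ (Fin m)) : EReal :=
  (((1 / 2) * ‖y‖ ^ 2 + inner ℝ b y : ℝ) : EReal) + kappaConj lam (-(A.transpose.toEuclideanLin y))

/-- `x` is an optimal solution of (P). -/
def IsPrimalSol {m n : ℕ} (A : Matrix (Fin m) (Fin n) ℝ) (b : EuclideanSpace ℝ (Fin m))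
    (lam : Fin n → ℝ) (x : EuclideanSpace ℝ (Fin n)) : Prop :=
  IsMaxOn (primalObj A b lam) univ x

/-- `y` is an optimal solution of (D). -/
def IsDualSol {m n : ℕ} (A : Matrix (Fin m) (Fin n) ℝ) (b : EuclideanSpace ℝ (Fin m))
    (lam : Fin n → ℝ) (y : EuclideanSpace ℝ (Fin m)) : Prop :=
  IsMinOn (dualObj A b lam) univ y

/-- The augmented Lagrangian of (D),
`L_σ(y; x) = (1/2) ‖y‖² + ⟨b, y⟩ + inf_s {κ_λ*(s) - ⟨x, Aᵀ y + s⟩ + (σ/2) ‖Aᵀ y + s‖²}`. -/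
def augLag {m n : ℕ} (A : Matrix (Fin m) (Fin n) ℝ) (b : EuclideanSpace ℝ (Fin m))
    (lam : Fin n → ℝ) (σ : ℝ) (y : EuclideanSpace ℝ (Fin m)) (x : EuclideanSpace ℝ (Fin n)) :
    EReal :=
  (((1 / 2) * ‖y‖ ^ 2 + inner ℝ b y : ℝ) : EReal) +
    ⨅ s : EuclideanSpace ℝ (Fin n),
      (kappaConj lam s +
        ((-inner ℝ x (A.transpose.toEuclideanLin y + s)
          + (σ / 2) * ‖A.transpose.toEuclideanLin y + s‖ ^ 2 : ℝ) : EReal))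

/-- The inner objective `Ψ(y) = L_σ(y; x)` as a real function. For `σ > 0` and `λ ≥ 0` the
augmented Lagrangian is finite, as `κ_λ* ≥ 0`, `κ_λ*(0) = 0` and the infimum is at least
`-‖x‖² / (2σ)`. -/
def innerObj {m n : ℕ} (A : Matrix (Fin m) (Fin n) ℝ) (b : EuclideanSpace ℝ (Fin m))
    (lam : Fin n → ℝ) (σ : ℝ) (x : EuclideanSpace ℝ (Fin n)) (y : EuclideanSpace ℝ (Fin m)) : ℝ :=
  (augLag A b lam σ y x).toReal

/-- `(y k, x k)` is an infinite sequence generated by the inexact augmented Lagrangian method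
for (D) with penalty parameters `σ k`, where `y (k + 1)` approximately minimizes `Ψ_k` in the
sense of the stopping criterion (A) with tolerances `ε k`. -/
structure IsALMSequence {m n : ℕ} (A : Matrix (Fin m) (Fin n) ℝ) (b : EuclideanSpace ℝ (Fin m))
    (lam : Fin n → ℝ) (σ ε : ℕ → ℝ) (y : ℕ → EuclideanSpace ℝ (Fin m))
    (x : ℕ → EuclideanSpace ℝ (Fin n)) : Prop where
  /-- The initial penalty parameter is positive. -/
  sigma_pos : 0 < σ 0
  /-- The penalty parameters increase (weakly) to some limit in `(0, ∞]`. -/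
  sigma_mono : Monotone σ
  /-- The tolerances are nonnegative. -/
  eps_nonneg : ∀ k, 0 ≤ ε k
  /-- The tolerances are summable. -/
  eps_summable : Summable ε
  /-- Step 1 with criterion (A): `‖∇Ψ_k(y^{k+1})‖ ≤ ε_k / √σ_k`. -/
  criterionA : ∀ k, ‖gradient (innerObj A b lam (σ k) (x k)) (y (k + 1))‖ ≤ ε k / √(σ k)
  /-- Step 2: `x^{k+1} = Prox_{σ_k κ_λ}(x^k - σ_k Aᵀ y^{k+1})`. -/
  prox_step : ∀ k, IsProx (fun u => σ k * kappa lam u)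
    (x k - σ k • A.transpose.toEuclideanLin (y (k + 1))) (x (k + 1))

end SLOPE

end

namespace SLOPE

open Filter Topology

section Sublinear

variable {E F : Type*} [NormedAddCommGroup E] [InnerProductSpace ℝ E]
  [NormedAddCommGroup F] [InnerProductSpace ℝ F]

/-- A real function that is subadditive and positively homogeneous. -/
structure IsSublinear (f : E → ℝ) : Prop where
  add_le : ∀ x y, f (x + y) ≤ f x + f y
  smul_eq : ∀ (c : ℝ) (x), 0 ≤ c → f (c • x) = c * f x

/-- `u` is a subgradient of `f` at `p`. -/
def IsSubgradient (f : E → ℝ) (p u : E) : Prop :=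
  ∀ x, f p + inner ℝ (x - p) u ≤ f x

theorem IsSublinear.const_mul {f : E → ℝ} (hf : IsSublinear f) {σ : ℝ} (hσ : 0 ≤ σ) :
    IsSublinear (fun x => σ * f x) where
  add_le x y := by
    have := mul_le_mul_of_nonneg_left (hf.add_le x y) hσ
    linarith
  smul_eq c x hc := by rw [hf.smul_eq c x hc]; ring

theorem IsSublinear.map_zero {f : E → ℝ} (hf : IsSublinear f) : f 0 = 0 := by
  simpa using hf.smul_eq 0 0 le_rfl

theorem IsSublinear.subgradient_iff {f : E → ℝ} (hf : IsSublinear f) {p u : E} :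
    IsSubgradient f p u ↔ (∀ x, inner ℝ x u ≤ f x) ∧ inner ℝ p u = f p := by
  constructor
  · intro h
    have h0 := h 0
    have h2 := h ((2 : ℝ) • p)
    rw [hf.map_zero] at h0
    rw [hf.smul_eq 2 p (by norm_num)] at h2
    simp only [inner_sub_left, inner_zero_left, real_inner_smul_left] at h0 h2
    have hp : inner ℝ p u = f p := by linarith
    refine ⟨fun x => ?_, hp⟩
    have := h x
    rw [inner_sub_left] at this
    linarith
  · rintro ⟨h, hp⟩ x
    rw [inner_sub_left, hp]
    linarith [h x]

/-- First-order optimality condition for a least squares problem with a sublinear regularizer. -/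
theorem IsSublinear.first_order {f : E → ℝ} (hf : IsSublinear f) (T : E →ₗ[ℝ] F) (c : F) {p : E}
    (hp : ∀ x, (1 / 2) * ‖T p - c‖ ^ 2 + f p ≤ (1 / 2) * ‖T x - c‖ ^ 2 + f x) (x : E) :
    f p + inner ℝ (T (x - p)) (c - T p) ≤ f x := by
  have key : ∀ t ∈ Set.Ioo (0 : ℝ) 1,
      f p + inner ℝ (T (x - p)) (c - T p) ≤ f x + t * ((1 / 2) * ‖T (x - p)‖ ^ 2) := by
    rintro t ⟨ht0, ht1⟩
    have h1 := hp ((1 - t) • p + t • x)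
    have h2 : f ((1 - t) • p + t • x) ≤ (1 - t) * f p + t * f x := by
      refine (hf.add_le _ _).trans_eq ?_
      rw [hf.smul_eq _ _ (by linarith), hf.smul_eq _ _ ht0.le]
    have h3 : T ((1 - t) • p + t • x) - c = (T p - c) + t • T (x - p) := by
      simp only [map_add, map_smul, map_sub]
      module
    have h4 : inner ℝ (T (x - p)) (c - T p) = -inner ℝ (T p - c) (T (x - p)) := by
      rw [← inner_neg_left, neg_sub, real_inner_comm]
    rw [h3, norm_add_sq_real, norm_smul, Real.norm_of_nonneg ht0.le, real_inner_smul_right] at h1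
    rw [h4]
    refine le_of_mul_le_mul_left ?_ ht0
    nlinarith
  have hlim : Tendsto (fun t : ℝ => f x + t * ((1 / 2) * ‖T (x - p)‖ ^ 2)) (𝓝[>] 0) (𝓝 (f x)) := by
    have : Continuous fun t : ℝ => f x + t * ((1 / 2) * ‖T (x - p)‖ ^ 2) := by fun_prop
    simpa using (this.tendsto 0).mono_left nhdsWithin_le_nhds
  exact ge_of_tendsto hlim <| by
    filter_upwards [Ioo_mem_nhdsGT (zero_lt_one (α := ℝ))] with t ht using key t ht

/-- A function squeezed between its affine part and a quadratic majorant has the expected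
gradient. -/
theorem hasGradientAt_of_quadratic_bounds [CompleteSpace E] {φ : E → ℝ} {y g : E} {K : ℝ}
    (hlow : ∀ h, φ y + inner ℝ g h ≤ φ (y + h))
    (hup : ∀ h, φ (y + h) ≤ φ y + inner ℝ g h + K * ‖h‖ ^ 2) : HasGradientAt φ g y := by
  rw [hasGradientAt_iff_isLittleO]
  have hO : (fun z => φ z - φ y - inner ℝ g (z - y)) =O[𝓝 y] fun z => ‖z - y‖ ^ 2 := by
    refine Asymptotics.IsBigO.of_bound K (Eventually.of_forall fun z => ?_)
    have h1 := hlow (z - y)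
    have h2 := hup (z - y)
    rw [add_sub_cancel] at h1 h2
    rw [Real.norm_of_nonneg (by linarith), Real.norm_of_nonneg (by positivity)]
    linarith
  refine hO.trans_isLittleO ?_
  exact Asymptotics.isLittleO_pow_sub_sub y (by norm_num)

end Sublinear

section Kappa

variable {n : ℕ} {lam : Fin n → ℝ}

theorem sum_mul_abs_perm_le_kappa (hlam : Antitone lam) (x : EuclideanSpace ℝ (Fin n))
    (τ : Equiv.Perm (Fin n)) : ∑ i, lam i * |x (τ i)| ≤ kappa lam x := by
  have hm : Monovary lam (absSorted x) := hlam.monovary (absSorted_antitone x)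
  have h := hm.sum_mul_comp_perm_le_sum_mul
    (σ := τ.trans (Tuple.sort (fun j => -|x j|)).symm)
  simpa [absSorted, kappa] using h

theorem kappa_eq_sum (lam : Fin n → ℝ) (x : EuclideanSpace ℝ (Fin n)) :
    ∃ τ : Equiv.Perm (Fin n), kappa lam x = ∑ i, lam i * |x (τ i)| :=
  ⟨_, rfl⟩

theorem isSublinear_kappa (hlam : Antitone lam) (hnn : ∀ i, 0 ≤ lam i) :
    IsSublinear (kappa lam) where
  add_le x y := by
    obtain ⟨τ, hτ⟩ := kappa_eq_sum lam (x + y)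
    rw [hτ]
    refine le_trans ?_ (add_le_add (sum_mul_abs_perm_le_kappa hlam x τ)
      (sum_mul_abs_perm_le_kappa hlam y τ))
    rw [← Finset.sum_add_distrib]
    refine Finset.sum_le_sum fun i _ => ?_
    rw [← mul_add]
    exact mul_le_mul_of_nonneg_left (abs_add_le _ _) (hnn i)
  smul_eq c x hc := by
    have hsum : ∀ τ : Equiv.Perm (Fin n),
        ∑ i, lam i * |(c • x) (τ i)| = c * ∑ i, lam i * |x (τ i)| := by
      intro τ
      rw [Finset.mul_sum]
      refine Finset.sum_congr rfl fun i _ => ?_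
      rw [PiLp.smul_apply, smul_eq_mul, abs_mul, abs_of_nonneg hc]
      ring
    refine le_antisymm ?_ ?_
    · obtain ⟨τ, hτ⟩ := kappa_eq_sum lam (c • x)
      rw [hτ, hsum]
      exact mul_le_mul_of_nonneg_left (sum_mul_abs_perm_le_kappa hlam x τ) hc
    · obtain ⟨τ, hτ⟩ := kappa_eq_sum lam x
      rw [hτ, ← hsum]
      exact sum_mul_abs_perm_le_kappa hlam (c • x) τ

theorem kappa_le_norm (hnn : ∀ i, 0 ≤ lam i) (x : EuclideanSpace ℝ (Fin n)) :
    kappa lam x ≤ (∑ i, lam i) * ‖x‖ := by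
  rw [kappa, Finset.sum_mul]
  exact Finset.sum_le_sum fun i _ =>
    mul_le_mul_of_nonneg_left (PiLp.norm_apply_le x _) (hnn i)

theorem continuous_kappa (hlam : Antitone lam) (hnn : ∀ i, 0 ≤ lam i) :
    Continuous (kappa lam) := by
  have hs : 0 ≤ ∑ i, lam i := Finset.sum_nonneg fun i _ => hnn i
  have hle : ∀ x y, kappa lam x ≤ kappa lam y + (∑ i, lam i) * dist x y := by
    intro x y
    have h := (isSublinear_kappa hlam hnn).add_le y (x - y)
    rw [add_sub_cancel] at h
    rw [dist_eq_norm]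
    linarith [kappa_le_norm hnn (x - y)]
  exact (LipschitzWith.of_le_add_mul (Real.toNNReal (∑ i, lam i)) fun x y => by
    rw [Real.coe_toNNReal _ hs]; exact hle x y).continuous

theorem lam_zero_mul_abs_le_kappa (hn : 0 < n) (hlam : Antitone lam) (hnn : ∀ i, 0 ≤ lam i)
    (x : EuclideanSpace ℝ (Fin n)) (j : Fin n) : lam ⟨0, hn⟩ * |x j| ≤ kappa lam x := by
  refine le_trans ?_ (sum_mul_abs_perm_le_kappa hlam x (Equiv.swap ⟨0, hn⟩ j))
  have := Finset.single_le_sum (f := fun i => lam i * |x (Equiv.swap ⟨0, hn⟩ j i)|)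
    (fun i _ => mul_nonneg (hnn i) (abs_nonneg _)) (Finset.mem_univ (⟨0, hn⟩ : Fin n))
  simpa using this

theorem exists_mul_norm_le_kappa (hn : 0 < n) (hlam : Antitone lam) (hnn : ∀ i, 0 ≤ lam i)
    (hpos : 0 < lam ⟨0, hn⟩) :
    ∃ c > 0, ∀ x : EuclideanSpace ℝ (Fin n), c * ‖x‖ ≤ kappa lam x := by
  have hn' : (0 : ℝ) < n := by exact_mod_cast hn
  refine ⟨lam ⟨0, hn⟩ / n, by positivity, fun x => ?_⟩
  have h1 : ‖x‖ ≤ ∑ j, |x j| := by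
    have hx : x = ∑ j, x j • EuclideanSpace.single j (1 : ℝ) := by
      ext i
      simp [Pi.single_apply]
    calc ‖x‖ = ‖∑ j, x j • EuclideanSpace.single j (1 : ℝ)‖ := by rw [← hx]
      _ ≤ ∑ j, ‖x j • EuclideanSpace.single j (1 : ℝ)‖ := norm_sum_le _ _
      _ = ∑ j, |x j| := by simp [norm_smul]
  have h2 : lam ⟨0, hn⟩ * ∑ j, |x j| ≤ n * kappa lam x := by
    rw [Finset.mul_sum]
    refine (Finset.sum_le_sum fun j _ => lam_zero_mul_abs_le_kappa hn hlam hnn x j).trans_eq ?_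
    simp
  rw [div_mul_eq_mul_div, div_le_iff₀ hn']
  nlinarith [mul_le_mul_of_nonneg_left h1 hpos.le]

theorem kappaConj_nonneg (hlam : Antitone lam) (hnn : ∀ i, 0 ≤ lam i)
    (v : EuclideanSpace ℝ (Fin n)) : 0 ≤ kappaConj lam v := by
  refine le_iSup_of_le 0 ?_
  simp [(isSublinear_kappa hlam hnn).map_zero]

theorem kappaConj_eq_zero (hlam : Antitone lam) (hnn : ∀ i, 0 ≤ lam i)
    {v : EuclideanSpace ℝ (Fin n)} (hv : ∀ x, inner ℝ x v ≤ kappa lam x) :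
    kappaConj lam v = 0 := by
  refine le_antisymm (iSup_le fun x => ?_) (kappaConj_nonneg hlam hnn v)
  exact_mod_cast sub_nonpos.2 (hv x)

theorem kappaConj_eq_top (hlam : Antitone lam) (hnn : ∀ i, 0 ≤ lam i)
    {v : EuclideanSpace ℝ (Fin n)} (hv : ¬ ∀ x, inner ℝ x v ≤ kappa lam x) :
    kappaConj lam v = ⊤ := by
  push Not at hv
  obtain ⟨x, hx⟩ := hv
  rw [EReal.eq_top_iff_forall_lt]
  intro r
  have hd : 0 < inner ℝ x v - kappa lam x := sub_pos.2 hx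
  set t : ℝ := (|r| + 1) / (inner ℝ x v - kappa lam x) with ht
  have ht0 : 0 ≤ t := by positivity
  refine lt_of_lt_of_le ?_ (le_iSup _ (t • x))
  rw [(isSublinear_kappa hlam hnn).smul_eq t x ht0, real_inner_smul_left, ← mul_sub, ht,
    div_mul_cancel₀ _ hd.ne']
  exact_mod_cast (le_abs_self r).trans_lt (lt_add_one _)

end Kappa

section Problem

variable {m n : ℕ} {A : Matrix (Fin m) (Fin n) ℝ} {b : EuclideanSpace ℝ (Fin m)}
  {lam : Fin n → ℝ}

theorem inner_toEuclideanLin (A : Matrix (Fin m) (Fin n) ℝ) (x : EuclideanSpace ℝ (Fin n))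
    (y : EuclideanSpace ℝ (Fin m)) :
    inner ℝ (A.toEuclideanLin x) y = inner ℝ x (A.transpose.toEuclideanLin y) := by
  rw [← Matrix.conjTranspose_eq_transpose_of_trivial,
    Matrix.toEuclideanLin_conjTranspose_eq_adjoint, LinearMap.adjoint_inner_right]

theorem isPrimalSol_iff (hlam : Antitone lam) (hnn : ∀ i, 0 ≤ lam i)
    {x : EuclideanSpace ℝ (Fin n)} :
    IsPrimalSol A b lam x ↔ IsSubgradient (kappa lam) x
      (-(A.transpose.toEuclideanLin (A.toEuclideanLin x - b))) := by
  constructor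
  · intro h z
    have := (isSublinear_kappa hlam hnn).first_order A.toEuclideanLin b (p := x)
      (fun z => by
        have : primalObj A b lam z ≤ primalObj A b lam x := h (Set.mem_univ z)
        unfold primalObj at this
        linarith) z
    rwa [inner_toEuclideanLin, ← neg_sub (A.toEuclideanLin x) b, map_neg] at this
  · intro h z _
    have hz := h z
    rw [← map_neg, ← inner_toEuclideanLin, inner_neg_right, real_inner_comm] at hz
    have h3 : A.toEuclideanLin z - b = (A.toEuclideanLin x - b) + A.toEuclideanLin (z - x) := by
      rw [map_sub]; abel
    change primalObj A b lam z ≤ primalObj A b lam x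
    unfold primalObj
    rw [h3, norm_add_sq_real]
    nlinarith [sq_nonneg ‖A.toEuclideanLin (z - x)‖]

theorem exists_isPrimalSol (hn : 0 < n) (A : Matrix (Fin m) (Fin n) ℝ)
    (b : EuclideanSpace ℝ (Fin m)) (hlam : Antitone lam) (hnn : ∀ i, 0 ≤ lam i)
    (hpos : 0 < lam ⟨0, hn⟩) : ∃ x, IsPrimalSol A b lam x := by
  obtain ⟨c, hc, hck⟩ := exists_mul_norm_le_kappa hn hlam hnn hpos
  have hT : Continuous A.toEuclideanLin := LinearMap.continuous_of_finiteDimensional _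
  have hκ := continuous_kappa hlam hnn
  have hcont : Continuous fun x => -primalObj A b lam x := by
    unfold primalObj
    fun_prop
  have hcoer : Tendsto (fun x => -primalObj A b lam x) (cocompact _) atTop := by
    refine tendsto_atTop_mono (fun x => ?_) (tendsto_norm_cocompact_atTop.const_mul_atTop hc)
    refine (hck x).trans ?_
    unfold primalObj
    nlinarith [sq_nonneg ‖A.toEuclideanLin x - b‖]
  obtain ⟨x, hx⟩ := hcont.exists_forall_le hcoer
  exact ⟨x, fun z _ => neg_le_neg_iff.1 (hx z)⟩

/-- Weak duality with the quadratic growth of the dual objective. -/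
theorem dualObj_growth (hlam : Antitone lam) (hnn : ∀ i, 0 ≤ lam i)
    {x : EuclideanSpace ℝ (Fin n)} (hx : IsPrimalSol A b lam x) (y : EuclideanSpace ℝ (Fin m)) :
    dualObj A b lam (A.toEuclideanLin x - b) +
      (((1 / 2) * ‖y - (A.toEuclideanLin x - b)‖ ^ 2 : ℝ) : EReal) ≤ dualObj A b lam y := by
  obtain ⟨hC, hxw⟩ :=
    (isSublinear_kappa hlam hnn).subgradient_iff.1 ((isPrimalSol_iff hlam hnn).1 hx)
  obtain ⟨w, hw⟩ : ∃ w, A.toEuclideanLin x - b = w := ⟨_, rfl⟩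
  rw [hw] at hC hxw ⊢
  unfold dualObj
  by_cases hy : ∀ z, inner ℝ z (-(A.transpose.toEuclideanLin y)) ≤ kappa lam z
  · rw [kappaConj_eq_zero hlam hnn hC, kappaConj_eq_zero hlam hnn hy, add_zero, add_zero,
      ← EReal.coe_add, EReal.coe_le_coe_iff]
    have h1 := hy x
    rw [← hxw, inner_neg_right, inner_neg_right, ← inner_toEuclideanLin, ← inner_toEuclideanLin,
      show A.toEuclideanLin x = w + b by rw [← hw]; abel, inner_add_left, inner_add_left] at h1
    rw [norm_sub_sq_real, real_inner_comm w y]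
    rw [real_inner_self_eq_norm_sq] at h1
    linarith
  · rw [kappaConj_eq_top hlam hnn hy, EReal.coe_add_top]
    exact le_top

theorem dualObj_ne_top (hlam : Antitone lam) (hnn : ∀ i, 0 ≤ lam i)
    {x : EuclideanSpace ℝ (Fin n)} (hx : IsPrimalSol A b lam x) :
    ∃ r : ℝ, dualObj A b lam (A.toEuclideanLin x - b) = r := by
  obtain ⟨hC, -⟩ :=
    (isSublinear_kappa hlam hnn).subgradient_iff.1 ((isPrimalSol_iff hlam hnn).1 hx)
  exact ⟨_, by rw [dualObj, kappaConj_eq_zero hlam hnn hC, add_zero]⟩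

theorem isDualSol_of_isPrimalSol (hlam : Antitone lam) (hnn : ∀ i, 0 ≤ lam i)
    {x : EuclideanSpace ℝ (Fin n)} (hx : IsPrimalSol A b lam x) :
    IsDualSol A b lam (A.toEuclideanLin x - b) := by
  intro y _
  refine le_trans ?_ (dualObj_growth hlam hnn hx y)
  obtain ⟨r, hr⟩ := dualObj_ne_top hlam hnn hx
  rw [hr, ← EReal.coe_add, EReal.coe_le_coe_iff]
  exact le_add_of_nonneg_right (by positivity)

theorem IsDualSol.eq_of_isPrimalSol (hlam : Antitone lam) (hnn : ∀ i, 0 ≤ lam i)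
    {x : EuclideanSpace ℝ (Fin n)} (hx : IsPrimalSol A b lam x) {y : EuclideanSpace ℝ (Fin m)}
    (hy : IsDualSol A b lam y) : y = A.toEuclideanLin x - b := by
  have h := (dualObj_growth hlam hnn hx y).trans (hy (Set.mem_univ (A.toEuclideanLin x - b)))
  obtain ⟨r, hr⟩ := dualObj_ne_top hlam hnn hx
  rw [hr, ← EReal.coe_add, EReal.coe_le_coe_iff] at h
  have h0 : ‖y - (A.toEuclideanLin x - b)‖ ^ 2 = 0 :=
    le_antisymm (by linarith) (by positivity)
  exact sub_eq_zero.1 (norm_eq_zero.1 (pow_eq_zero_iff two_ne_zero |>.1 h0))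

end Problem

section AugmentedLagrangian

variable {m n : ℕ} {A : Matrix (Fin m) (Fin n) ℝ} {b : EuclideanSpace ℝ (Fin m)}
  {lam : Fin n → ℝ}

theorem IsProx.isSubgradient (hlam : Antitone lam) (hnn : ∀ i, 0 ≤ lam i) {σ : ℝ} (hσ : 0 < σ)
    {z p : EuclideanSpace ℝ (Fin n)} (hp : IsProx (fun u => σ * kappa lam u) z p) :
    IsSubgradient (kappa lam) p (σ⁻¹ • (z - p)) := by
  intro x
  have h := ((isSublinear_kappa hlam hnn).const_mul hσ.le).first_order LinearMap.id z (p := p)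
    (fun x => hp (Set.mem_univ x)) x
  simp only [LinearMap.id_apply] at h
  rw [real_inner_smul_right]
  refine le_of_mul_le_mul_left ?_ hσ
  rwa [mul_add, mul_inv_cancel_left₀ hσ.ne']

/-- The penalty term of the augmented Lagrangian expanded around the point `q` with
`x - σ q = p`. -/
theorem penalty_expand {E : Type*} [NormedAddCommGroup E] [InnerProductSpace ℝ E] {σ : ℝ}
    {x p q : E} (hq : σ • q = x - p) (r : E) :
    -inner ℝ x (q + r) + (σ / 2) * ‖q + r‖ ^ 2 =
      (-inner ℝ x q + (σ / 2) * ‖q‖ ^ 2) - inner ℝ p r + (σ / 2) * ‖r‖ ^ 2 := by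
  have h : σ * inner ℝ q r = inner ℝ x r - inner ℝ p r := by
    rw [← real_inner_smul_left, hq, inner_sub_left]
  rw [inner_add_right, norm_add_sq_real]
  linarith

/-- The inner objective is differentiable, with `∇Ψ(y) = y + b - A p`, where `p` is the proximal
point of `x - σ Aᵀ y`. -/
theorem hasGradientAt_innerObj (hlam : Antitone lam) (hnn : ∀ i, 0 ≤ lam i) {σ : ℝ} (hσ : 0 < σ)
    {x p : EuclideanSpace ℝ (Fin n)} {y : EuclideanSpace ℝ (Fin m)}
    (hp : IsProx (fun u => σ * kappa lam u) (x - σ • A.transpose.toEuclideanLin y) p) :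
    HasGradientAt (innerObj A b lam σ x) (y + b - A.toEuclideanLin p) y := by
  set B := A.transpose.toEuclideanLin with hB
  obtain ⟨hC, hpu⟩ := (isSublinear_kappa hlam hnn).subgradient_iff.1 (hp.isSubgradient hlam hnn hσ)
  set u := σ⁻¹ • (x - σ • B y - p) with hu
  have hq : σ • (B y + u) = x - p := by
    rw [hu, smul_add, smul_inv_smul₀ hσ.ne']; abel
  set c := -inner ℝ x (B y + u) + (σ / 2) * ‖B y + u‖ ^ 2 with hc
  set Q : EuclideanSpace ℝ (Fin m) → ℝ := fun z => (1 / 2) * ‖z‖ ^ 2 + inner ℝ b z with hQ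
  have hlow : ∀ h, ((Q (y + h) + (c - inner ℝ p (B h)) : ℝ) : EReal) ≤
      augLag A b lam σ (y + h) x := by
    intro h
    rw [EReal.coe_add]
    refine add_le_add le_rfl (le_iInf fun s => ?_)
    by_cases hs : ∀ z, inner ℝ z s ≤ kappa lam z
    · rw [kappaConj_eq_zero hlam hnn hs, zero_add, EReal.coe_le_coe_iff, ← hB,
        show B (y + h) + s = (B y + u) + (B h + (s - u)) by rw [map_add]; abel,
        penalty_expand hq, inner_add_right (x := p), inner_sub_right]
      have := hs p
      have : 0 ≤ (σ / 2) * ‖B h + (s - u)‖ ^ 2 := by positivity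
      linarith
    · rw [kappaConj_eq_top hlam hnn hs, EReal.top_add_coe]
      exact le_top
  have hup : ∀ h, augLag A b lam σ (y + h) x ≤
      ((Q (y + h) + (c - inner ℝ p (B h) + (σ / 2) * ‖B h‖ ^ 2) : ℝ) : EReal) := by
    intro h
    rw [EReal.coe_add]
    refine add_le_add le_rfl (iInf_le_of_le u ?_)
    rw [kappaConj_eq_zero hlam hnn hC, zero_add, EReal.coe_le_coe_iff, ← hB,
      show B (y + h) + u = (B y + u) + B h by rw [map_add]; abel, penalty_expand hq]
  have hcoe : ∀ h, ((innerObj A b lam σ x (y + h) : ℝ) : EReal) = augLag A b lam σ (y + h) x :=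
    fun h => EReal.coe_toReal
      (ne_top_of_le_ne_top (EReal.coe_ne_top _) (hup h))
      (ne_bot_of_le_ne_bot (EReal.coe_ne_bot _) (hlow h))
  have hlow' : ∀ h, Q (y + h) + (c - inner ℝ p (B h)) ≤ innerObj A b lam σ x (y + h) := by
    intro h
    have := hlow h
    rwa [← hcoe, EReal.coe_le_coe_iff] at this
  have hup' : ∀ h, innerObj A b lam σ x (y + h) ≤
      Q (y + h) + (c - inner ℝ p (B h) + (σ / 2) * ‖B h‖ ^ 2) := by
    intro h
    have := hup h
    rwa [← hcoe, EReal.coe_le_coe_iff] at this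
  have h0 : innerObj A b lam σ x y = Q y + c := by
    have h1 := hlow' 0
    have h2 := hup' 0
    simp only [add_zero, map_zero, inner_zero_right, norm_zero] at h1 h2
    refine le_antisymm ?_ ?_ <;> linarith
  have hQh : ∀ h, Q (y + h) = Q y + inner ℝ (y + b) h + (1 / 2) * ‖h‖ ^ 2 := by
    intro h
    simp only [hQ]
    rw [norm_add_sq_real, inner_add_right, inner_add_left]
    ring
  have hpB : ∀ h, inner ℝ p (B h) = inner ℝ (A.toEuclideanLin p) h := fun h =>
    (inner_toEuclideanLin A p h).symm
  have hBc : ∀ h, ‖B h‖ ≤ ‖LinearMap.toContinuousLinearMap B‖ * ‖h‖ := fun h =>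
    (LinearMap.toContinuousLinearMap B).le_opNorm h
  refine hasGradientAt_of_quadratic_bounds
    (K := 1 / 2 + (σ / 2) * ‖LinearMap.toContinuousLinearMap B‖ ^ 2) (fun h => ?_) (fun h => ?_)
  · have h1 := hlow' h
    rw [hQh, hpB] at h1
    rw [h0, inner_sub_left]
    have : 0 ≤ ‖h‖ ^ 2 := by positivity
    linarith
  · have h1 := hup' h
    rw [hQh, hpB] at h1
    rw [h0, inner_sub_left]
    have h2 : (σ / 2) * ‖B h‖ ^ 2 ≤
        (σ / 2) * (‖LinearMap.toContinuousLinearMap B‖ * ‖h‖) ^ 2 :=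
      mul_le_mul_of_nonneg_left (pow_le_pow_left₀ (norm_nonneg _) (hBc h) 2) (by positivity)
    rw [mul_pow] at h2
    linarith

end AugmentedLagrangian

section Convergence

/-- The Robbins-Siegmund lemma for deterministic sequences. -/
theorem tendsto_and_summable_of_le_add {a d c : ℕ → ℝ} (ha : ∀ k, 0 ≤ a k) (hd : ∀ k, 0 ≤ d k)
    (hc : ∀ k, 0 ≤ c k) (hcs : Summable c) (h : ∀ k, a (k + 1) + d k ≤ a k + c k) :
    (∃ l, Tendsto a atTop (𝓝 l)) ∧ Summable d := by
  have hle : ∀ k, ∑ i ∈ Finset.range k, c i ≤ ∑' i, c i := fun k =>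
    hcs.sum_le_tsum _ fun i _ => hc i
  constructor
  · have hanti : Antitone fun k => a k - ∑ i ∈ Finset.range k, c i := by
      refine antitone_nat_of_succ_le fun k => ?_
      rw [Finset.sum_range_succ]
      linarith [h k, hd k]
    have hbdd : BddBelow (Set.range fun k => a k - ∑ i ∈ Finset.range k, c i) := by
      refine ⟨-∑' i, c i, ?_⟩
      rintro _ ⟨k, rfl⟩
      have := hle k
      have := ha k
      simp only
      linarith
    have h1 := (tendsto_atTop_ciInf hanti hbdd).add hcs.hasSum.tendsto_sum_nat
    exact ⟨_, h1.congr fun k => by ring⟩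
  · refine summable_of_sum_range_le (c := a 0 + ∑' i, c i) hd fun k => ?_
    have key : a k + ∑ i ∈ Finset.range k, d i ≤ a 0 + ∑ i ∈ Finset.range k, c i := by
      induction k with
      | zero => simp
      | succ k ih =>
        rw [Finset.sum_range_succ, Finset.sum_range_succ]
        linarith [h k]
    linarith [hle k, ha k]

variable {m n : ℕ} {A : Matrix (Fin m) (Fin n) ℝ} {b : EuclideanSpace ℝ (Fin m)}
  {lam : Fin n → ℝ} {σ ε : ℕ → ℝ} {y : ℕ → EuclideanSpace ℝ (Fin m)}
  {x : ℕ → EuclideanSpace ℝ (Fin n)}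

namespace IsALMSequence

theorem sigma_zero_le (h : IsALMSequence A b lam σ ε y x) (k : ℕ) : σ 0 ≤ σ k :=
  h.sigma_mono (Nat.zero_le k)

theorem sigma_pos' (h : IsALMSequence A b lam σ ε y x) (k : ℕ) : 0 < σ k :=
  h.sigma_pos.trans_le (h.sigma_zero_le k)

theorem mul_residual_sq_le (h : IsALMSequence A b lam σ ε y x) (hlam : Antitone lam)
    (hnn : ∀ i, 0 ≤ lam i) (k : ℕ) :
    σ k * ‖y (k + 1) + b - A.toEuclideanLin (x (k + 1))‖ ^ 2 ≤ ε k ^ 2 := by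
  have h1 := h.criterionA k
  rw [(hasGradientAt_innerObj hlam hnn (h.sigma_pos' k) (h.prox_step k)).gradient] at h1
  have h2 := pow_le_pow_left₀ (norm_nonneg _) h1 2
  rw [div_pow, Real.sq_sqrt (h.sigma_pos' k).le, le_div_iff₀ (h.sigma_pos' k)] at h2
  linarith

theorem isSubgradient (h : IsALMSequence A b lam σ ε y x) (hlam : Antitone lam)
    (hnn : ∀ i, 0 ≤ lam i) (k : ℕ) :
    IsSubgradient (kappa lam) (x (k + 1))
      ((σ k)⁻¹ • (x k - x (k + 1)) - A.transpose.toEuclideanLin (y (k + 1))) := by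
  have h1 := (h.prox_step k).isSubgradient hlam hnn (h.sigma_pos' k)
  convert h1 using 1
  rw [sub_right_comm, smul_sub (σ k)⁻¹ (x k - x (k + 1)), inv_smul_smul₀ (h.sigma_pos' k).ne']

/-- Quasi-Fejér monotonicity with respect to the primal solution set. -/
theorem fejer (h : IsALMSequence A b lam σ ε y x) (hlam : Antitone lam)
    (hnn : ∀ i, 0 ≤ lam i) {xs : EuclideanSpace ℝ (Fin n)} (hxs : IsPrimalSol A b lam xs)
    (k : ℕ) :
    ‖x (k + 1) - xs‖ ^ 2 + (‖x k - x (k + 1)‖ ^ 2 +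
      σ k * ‖A.toEuclideanLin (x (k + 1)) - A.toEuclideanLin xs‖ ^ 2) ≤
      ‖x k - xs‖ ^ 2 + ε k ^ 2 := by
  have hσ := h.sigma_pos' k
  have hres := h.mul_residual_sq_le hlam hnn k
  have h1 := h.isSubgradient hlam hnn k xs
  have h2 := (isPrimalSol_iff hlam hnn).1 hxs (x (k + 1))
  set p := x (k + 1) with hp
  set e := y (k + 1) + b - A.toEuclideanLin p with he
  set δ := A.toEuclideanLin p - A.toEuclideanLin xs with hδ
  have hy : y (k + 1) = (A.toEuclideanLin xs - b) + (δ + e) := by rw [he, hδ]; abel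
  rw [← neg_sub p xs, inner_neg_left, inner_sub_right, real_inner_smul_right,
    ← inner_toEuclideanLin, map_sub, ← hδ, hy, inner_add_right, inner_add_right,
    real_inner_self_eq_norm_sq] at h1
  rw [inner_neg_right, ← inner_toEuclideanLin, map_sub, ← hδ] at h2
  have h3 : ‖δ‖ ^ 2 + inner ℝ δ e ≤ (σ k)⁻¹ * inner ℝ (p - xs) (x k - p) := by linarith
  have h4 : σ k * (‖δ‖ ^ 2 + inner ℝ δ e) ≤ inner ℝ (p - xs) (x k - p) := by
    have := mul_le_mul_of_nonneg_left h3 hσ.le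
    rwa [mul_inv_cancel_left₀ hσ.ne'] at this
  have h5 : 0 ≤ σ k * ‖δ + e‖ ^ 2 := by positivity
  rw [norm_add_sq_real] at h5
  have h6 : ‖x k - xs‖ ^ 2 = ‖p - xs‖ ^ 2 + 2 * inner ℝ (p - xs) (x k - p) + ‖x k - p‖ ^ 2 := by
    rw [← norm_add_sq_real]; congr 2; abel
  rw [h6]
  nlinarith

theorem summable_eps_sq (h : IsALMSequence A b lam σ ε y x) : Summable fun k => ε k ^ 2 := by
  obtain ⟨R, hR⟩ := h.eps_summable.tendsto_atTop_zero.bddAbove_range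
  refine Summable.of_nonneg_of_le (fun k => sq_nonneg _) (fun k => ?_)
    (h.eps_summable.mul_left R)
  rw [sq]
  exact mul_le_mul_of_nonneg_right (hR ⟨k, rfl⟩) (h.eps_nonneg k)

theorem fejer_limits (h : IsALMSequence A b lam σ ε y x) (hlam : Antitone lam)
    (hnn : ∀ i, 0 ≤ lam i) {xs : EuclideanSpace ℝ (Fin n)} (hxs : IsPrimalSol A b lam xs) :
    (∃ l, Tendsto (fun k => ‖x k - xs‖ ^ 2) atTop (𝓝 l)) ∧
    Summable (fun k => ‖x k - x (k + 1)‖ ^ 2 +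
      σ k * ‖A.toEuclideanLin (x (k + 1)) - A.toEuclideanLin xs‖ ^ 2) :=
  tendsto_and_summable_of_le_add (fun _ => by positivity)
    (fun k => add_nonneg (by positivity) (mul_nonneg (h.sigma_pos' k).le (by positivity)))
    (fun _ => sq_nonneg _) h.summable_eps_sq
    (fun k => h.fejer hlam hnn hxs k)

end IsALMSequence

theorem tendsto_zero_of_norm_sq {E : Type*} [NormedAddCommGroup E] {u : ℕ → E} {v : ℕ → ℝ}
    (huv : ∀ k, ‖u k‖ ^ 2 ≤ v k) (hv : Tendsto v atTop (𝓝 0)) : Tendsto u atTop (𝓝 0) := by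
  rw [tendsto_zero_iff_norm_tendsto_zero]
  have h1 := squeeze_zero (fun k => sq_nonneg ‖u k‖) huv hv
  have h2 := (Real.continuous_sqrt.tendsto 0).comp h1
  rw [Real.sqrt_zero] at h2
  exact h2.congr fun k => Real.sqrt_sq (norm_nonneg _)

namespace IsALMSequence

theorem tendsto_diff (h : IsALMSequence A b lam σ ε y x) (hlam : Antitone lam)
    (hnn : ∀ i, 0 ≤ lam i) {xs : EuclideanSpace ℝ (Fin n)} (hxs : IsPrimalSol A b lam xs) :
    Tendsto (fun k => x k - x (k + 1)) atTop (𝓝 0) :=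
  tendsto_zero_of_norm_sq
    (fun k => le_add_of_nonneg_right (mul_nonneg (h.sigma_pos' k).le (by positivity)))
    (h.fejer_limits hlam hnn hxs).2.tendsto_atTop_zero

theorem tendsto_image (h : IsALMSequence A b lam σ ε y x) (hlam : Antitone lam)
    (hnn : ∀ i, 0 ≤ lam i) {xs : EuclideanSpace ℝ (Fin n)} (hxs : IsPrimalSol A b lam xs) :
    Tendsto (fun k => A.toEuclideanLin (x (k + 1))) atTop (𝓝 (A.toEuclideanLin xs)) := by
  have h1 := (h.fejer_limits hlam hnn hxs).2.tendsto_atTop_zero.const_mul (σ 0)⁻¹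
  rw [mul_zero] at h1
  refine tendsto_sub_nhds_zero_iff.1 (tendsto_zero_of_norm_sq (fun k => ?_) h1)
  rw [← div_eq_inv_mul, le_div_iff₀ h.sigma_pos, mul_comm]
  exact (mul_le_mul_of_nonneg_right (h.sigma_zero_le k) (by positivity)).trans
    (le_add_of_nonneg_left (by positivity))

theorem tendsto_dual (h : IsALMSequence A b lam σ ε y x) (hlam : Antitone lam)
    (hnn : ∀ i, 0 ≤ lam i) {xs : EuclideanSpace ℝ (Fin n)} (hxs : IsPrimalSol A b lam xs) :
    Tendsto y atTop (𝓝 (A.toEuclideanLin xs - b)) := by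
  rw [← tendsto_add_atTop_iff_nat 1]
  have he : Tendsto (fun k => y (k + 1) + b - A.toEuclideanLin (x (k + 1))) atTop (𝓝 0) := by
    have h1 := (h.eps_summable.tendsto_atTop_zero.pow 2).const_mul (σ 0)⁻¹
    rw [zero_pow two_ne_zero, mul_zero] at h1
    refine tendsto_zero_of_norm_sq (fun k => ?_) h1
    rw [← div_eq_inv_mul, le_div_iff₀ h.sigma_pos, mul_comm]
    exact (mul_le_mul_of_nonneg_right (h.sigma_zero_le k) (by positivity)).trans
      (h.mul_residual_sq_le hlam hnn k)
  have h2 := (he.add (h.tendsto_image hlam hnn hxs)).sub_const b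
  rw [zero_add] at h2
  exact h2.congr fun k => by abel

theorem tendsto_primal (h : IsALMSequence A b lam σ ε y x) (hlam : Antitone lam)
    (hnn : ∀ i, 0 ≤ lam i) {xs : EuclideanSpace ℝ (Fin n)} (hxs : IsPrimalSol A b lam xs) :
    ∃ xl, IsPrimalSol A b lam xl ∧ Tendsto x atTop (𝓝 xl) := by
  obtain ⟨l, hl⟩ := (h.fejer_limits hlam hnn hxs).1
  obtain ⟨R, hR⟩ := hl.bddAbove_range
  have hmem : ∀ k, x (k + 1) ∈ Metric.closedBall xs √R := by
    intro k
    rw [mem_closedBall_iff_norm]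
    exact Real.le_sqrt_of_sq_le (hR ⟨k + 1, rfl⟩)
  obtain ⟨xl, -, φ, hφ, hlim⟩ := (isCompact_closedBall xs √R).tendsto_subseq hmem
  have hT : Continuous A.toEuclideanLin := LinearMap.continuous_of_finiteDimensional _
  have hB : Continuous A.transpose.toEuclideanLin := LinearMap.continuous_of_finiteDimensional _
  have hκ := continuous_kappa hlam hnn
  have himg : A.toEuclideanLin xl = A.toEuclideanLin xs :=
    tendsto_nhds_unique ((hT.tendsto xl).comp hlim)
      ((h.tendsto_image hlam hnn hxs).comp hφ.tendsto_atTop)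
  have hdiff : Tendsto (fun k => (σ k)⁻¹ • (x k - x (k + 1))) atTop (𝓝 0) := by
    have h1 := (h.tendsto_diff hlam hnn hxs).norm.const_mul (σ 0)⁻¹
    rw [norm_zero, mul_zero] at h1
    refine squeeze_zero_norm (fun k => ?_) h1
    rw [norm_smul, Real.norm_of_nonneg (inv_nonneg.2 (h.sigma_pos' k).le)]
    exact mul_le_mul_of_nonneg_right (inv_anti₀ h.sigma_pos (h.sigma_zero_le k)) (norm_nonneg _)
  have hy := (tendsto_add_atTop_iff_nat 1).2 (h.tendsto_dual hlam hnn hxs)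
  have hsub : Tendsto (fun k => (σ k)⁻¹ • (x k - x (k + 1)) -
      A.transpose.toEuclideanLin (y (k + 1))) atTop
      (𝓝 (-(A.transpose.toEuclideanLin (A.toEuclideanLin xl - b)))) := by
    rw [himg, ← zero_sub]
    exact hdiff.sub ((hB.tendsto _).comp hy)
  have hxl : IsPrimalSol A b lam xl := by
    rw [isPrimalSol_iff hlam hnn]
    intro z
    have h1 := ((hκ.tendsto xl).comp hlim).add
      ((tendsto_const_nhds (x := z)).sub hlim |>.inner (𝕜 := ℝ) (hsub.comp hφ.tendsto_atTop))
    exact le_of_tendsto h1 (Eventually.of_forall fun k => h.isSubgradient hlam hnn (φ k) z)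
  refine ⟨xl, hxl, ?_⟩
  obtain ⟨r, hr⟩ := (h.fejer_limits hlam hnn hxl).1
  have hr0 : r = 0 := by
    refine tendsto_nhds_unique
      (((tendsto_add_atTop_iff_nat 1).2 hr).comp hφ.tendsto_atTop) ?_
    have h1 := (hlim.sub_const xl).norm.pow 2
    rwa [sub_self, norm_zero, zero_pow two_ne_zero] at h1
  subst hr0
  exact tendsto_sub_nhds_zero_iff.1 (tendsto_zero_of_norm_sq (fun k => le_rfl) hr)

end IsALMSequence

end Convergence

end SLOPE

theorem theorem2 {m n : ℕ} (hn : 0 < n)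
    (A : Matrix (Fin m) (Fin n) ℝ) (b : EuclideanSpace ℝ (Fin m))
    (lam : Fin n → ℝ) (hlam_anti : Antitone lam) (hlam_nonneg : ∀ i, 0 ≤ lam i)
    (hlam_pos : 0 < lam ⟨0, hn⟩)
    (σ ε : ℕ → ℝ) (y : ℕ → EuclideanSpace ℝ (Fin m)) (x : ℕ → EuclideanSpace ℝ (Fin n))
    (halg : SLOPE.IsALMSequence A b lam σ ε y x) :
    (∃ xstar : EuclideanSpace ℝ (Fin n),
      SLOPE.IsPrimalSol A b lam xstar ∧ Filter.Tendsto x Filter.atTop (nhds xstar)) ∧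
    (∃ ystar : EuclideanSpace ℝ (Fin m),
      SLOPE.IsDualSol A b lam ystar ∧
      (∀ y' : EuclideanSpace ℝ (Fin m), SLOPE.IsDualSol A b lam y' → y' = ystar) ∧
      Filter.Tendsto y Filter.atTop (nhds ystar)) := by
  obtain ⟨xs, hxs⟩ := SLOPE.exists_isPrimalSol hn A b hlam_anti hlam_nonneg hlam_pos
  exact ⟨halg.tendsto_primal hlam_anti hlam_nonneg hxs, A.toEuclideanLin xs - b,
    SLOPE.isDualSol_of_isPrimalSol hlam_anti hlam_nonneg hxs,
    fun _ hy => hy.eq_of_isPrimalSol hlam_anti hlam_nonneg hxs,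
    halg.tendsto_dual hlam_anti hlam_nonneg hxs⟩
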